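/- **Setting.** Let $\mathcal Z\subset\mathbb R^{\mathfrak d}$, $\mathcal X\subset\mathbb R^{\mathfrak p}$, let $P_Z$ be a probability measure on $\mathcal Z$ and $\mu_X^*$ a probability measure on $\mathcal X$. Write $|v|_\infty=\max_i|v_i|$ and $\||g|_\infty\|_\infty=\sup_{z\in\mathcal Z,\,x\in\mathcal X}|g(z,x)|_\infty$. For a measurable $g:\mathcal Z\times\mathcal X\to\mathbb R^D$ and $\sigma>0$ put $$p_{g,\sigma}(y|x)=\int \phi_\sigma\big(y-g(z,x)\big)\,dP_Z(z),\qquad y\in\mathbb R^D,$$ where $\phi_\sigma$ is the density of $\mathsf N(0,\sigma^2 I_D)$. Let $G_*:\mathcal Z\times\mathcal X\to\mathbb R^D$ be measurable, $\sigma_*>0$, $p_*=p_{G_*,\sigma_*}$. The data $(X_1,Y_1),\dots,(X_n,Y_n)$ are i.i.d. with $X_i\sim\mu_X^*$ and $Y_i\mid X_i=x$ having density $p_*(\cdot|x)$; $P_*$ denotes their law. Let $$d_H(p,q)=\mathbb E_{X\sim\mu_X^*}\Big[\Big(\int\big(\sqrt{p(y|X)}-\sqrt{q(y|X)}\big)^2dy\Big)^{1/2}\Big].$$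 Let $\mathcal F$ be a class of measurable functions $g:\mathcal Z\times\mathcal X\to\mathbb R^D$ with $\||g|_\infty\|_\infty\le K$ for all $g\in\mathcal F$, and let $0<\sigma_{\min}\le\sigma_{\max}$. With $\ell_n(g,\sigma)=n^{-1}\sum_{i=1}^n\log p_{g,\sigma}(Y_i|X_i)$, a sieve MLE with optimization error $\eta_n$ is any data-dependent pair $(\hat g,\hat\sigma)\in\mathcal F\times[\sigma_{\min},\sigma_{\max}]$ with $$\ell_n(\hat g,\hat\sigma)\ \ge\ \sup_{g\in\mathcal F,\ \sigma\in[\sigma_{\min},\sigma_{\max}]}\ell_n(g,\sigma)-\eta_n ,$$ and $\hat p=p_{\hat g,\hat\sigma}$. Let $\mathcal N(\delta,\mathcal F,\||\cdot|_\infty\|_\infty)$ be the $\delta$-covering number of $\mathcal F$. **Theorem.** There are a constant $C_1>0$ that is absolute, a constant $C_2=C_2(D)>0$ and a constant $C_3=C_3(D,K,\sigma_{\max})>0$ such that the following holds for every $\delta_*>0$ and every $n\ge1$. Suppose that $\sigma_{\min}\le1$, $\sigma_*\in[\sigma_{\min},\sigma_{\max}]$, and that for some $\xi\ge1$ and $A\ge1$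 $$\log\mathcal N\big(\delta,\mathcal F,\||\cdot|_\infty\|_\infty\big)\le\xi\{A+1\vee\log\delta^{-1}\}\qquad\text{for every }\delta\in(0,\delta_*].$$ Suppose that there are $\delta_{\mathrm{app}}\in(0,\delta_*]$ with $\delta_{\mathrm{app}}\le1$ and $G\in\mathcal F$ with $\||G-G_*|_\infty\|_\infty\le\delta_{\mathrm{app}}$. Put $$\varepsilon_n^*=C_3\left(\sqrt{\frac{\xi\{A+\log(n/\sigma_{\min})\}}{n}}\ \vee\ \frac{\delta_{\mathrm{app}}}{\sigma_*}\right).$$ If $\eta_n\le\varepsilon_n^{*2}/6$ and $\varepsilon_n^*\le\sqrt2\,\delta_*$, then every sieve MLE with optimization error $\eta_n$ satisfies $$P_*\big(d_H(\hat p,p_*)>\varepsilon_n^*\big)\le5e^{-C_1n\varepsilon_n^{*2}}+C_2n^{-1}.$$ -/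

import Mathlib

open MeasureTheory ProbabilityTheory

namespace CondGen

/-- Density of the centred normal distribution with covariance `σ² I` on `ℝ^D`.  The space `ℝ^D` is
`Fin D → ℝ`, whose norm is the maximum norm `|·|_∞` and whose `volume` is Lebesgue measure; the
Euclidean norm in the exponent is written out as a sum of squares. -/
noncomputable def gaussianDensity {D : ℕ} (σ : ℝ) (v : Fin D → ℝ) : ℝ :=
  (2 * Real.pi * σ ^ 2) ^ (-(D : ℝ) / 2) * Real.exp (-(∑ i, v i ^ 2) / (2 * σ ^ 2))

section Model

variable {Z X : Type*} [MeasurableSpace Z] [MeasurableSpace X] {D : ℕ}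

/-- The conditional density `p_{g,σ}(y | x) = ∫ φ_σ(y - g(z, x)) dP_Z(z)`. -/
noncomputable def condDensity (PZ : Measure Z) (g : Z × X → Fin D → ℝ) (σ : ℝ)
    (x : X) (y : Fin D → ℝ) : ℝ :=
  ∫ z, gaussianDensity σ (y - g (z, x)) ∂PZ

/-- The law of one observation `(X, Y)` when `X ∼ μ` and `Y` given `X = x` has Lebesgue density
`p(· | x)`. -/
noncomputable def pairLaw (μ : Measure X) (p : X → (Fin D → ℝ) → ℝ) :
    Measure (X × (Fin D → ℝ)) :=
  (μ.prod volume).withDensity fun w => ENNReal.ofReal (p w.1 w.2)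

/-- The Hellinger distance `(∫ (√p - √q)² dy)^{1/2}` between densities on `ℝ^D`. -/
noncomputable def hellinger (p q : (Fin D → ℝ) → ℝ) : ℝ :=
  Real.sqrt (∫ y, (Real.sqrt (p y) - Real.sqrt (q y)) ^ 2)

/-- The integrated Hellinger distance `E_X [d_H(p(· | X), q(· | X))]` between conditional
densities. -/
noncomputable def integratedHellinger (μ : Measure X) (p q : X → (Fin D → ℝ) → ℝ) : ℝ :=
  ∫ x, hellinger (p x) (q x) ∂μ

/-- The normalized log-likelihood `ℓ_n(g, σ) = n⁻¹ ∑ log p_{g,σ}(Y_i | X_i)`. -/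
noncomputable def logLik (PZ : Measure Z) {n : ℕ} (data : Fin n → X × (Fin D → ℝ))
    (g : Z × X → Fin D → ℝ) (σ : ℝ) : ℝ :=
  (n : ℝ)⁻¹ * ∑ i, Real.log (condDensity PZ g σ (data i).1 (data i).2)

/-- `(ĝ, σ̂) ∈ F × [σmin, σmax]` maximizes the log-likelihood of the data over
`F × [σmin, σmax]` up to `η`. -/
def IsSieveMLE (PZ : Measure Z) (F : Set (Z × X → Fin D → ℝ)) (σmin σmax η : ℝ) {n : ℕ}
    (data : Fin n → X × (Fin D → ℝ)) (ghat : Z × X → Fin D → ℝ) (σhat : ℝ) : Prop :=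
  ghat ∈ F ∧ σhat ∈ Set.Icc σmin σmax ∧
    ∀ g ∈ F, ∀ σ ∈ Set.Icc σmin σmax,
      logLik PZ data g σ - η ≤ logLik PZ data ghat σhat

end Model

/-- The metric entropy `log N(δ, F, ‖|·|_∞‖_∞)` of a class of `ℝ^D`-valued functions for the
supremum distance `sup_w |f(w) - g(w)|_∞`, as an extended real (`⊤` if no finite cover exists).
The centres of the balls are not required to lie in `F`. -/
noncomputable def supEntropy {W : Type*} {D : ℕ} (δ : ℝ) (F : Set (W → Fin D → ℝ)) : EReal :=
  ENNReal.log
    ((Metric.externalCoveringNumber δ.toNNReal (UniformFun.ofFun '' F) : ℕ∞) : ENNReal)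

/-- The rate `C (√(ξ (A + log (n / σmin)) / n) ∨ δapp / σs)`. -/
noncomputable def rate (C ξ A σmin δapp σs : ℝ) (n : ℕ) : ℝ :=
  C * max (Real.sqrt (ξ * (A + Real.log (n / σmin)) / n)) (δapp / σs)

end CondGen

/-!
The proof compares likelihood ratios with the truth `p_*`. If the sieve maximum likelihood estimator
`p̂` is at distance more than `ε` (the rate) from `p_*`, then, since it nearly beats the competitor
`p_{G,σ_*}`, either the log-likelihood of `p_{G,σ_*}` is below that of `p_*` by at least
`n ε² / 12`, or some `p_{g,σ}` at distance more than `ε` satisfies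
`∑ log (p_{g,σ} / p_*) ≥ -n ε² / 4`. Both events are controlled by Chernoff bounds
(`measure_le_sum_le_exp`), each contributing `exp(-n ε² / 24)`.

*Approximation.* Completing the square for Gaussians gives
`p_*² / p_{G,σ_*} ≤ exp(D δ² / σ_*²) r` with `r` the mixture density of generator `2 G_* - G`
(`condDensity_sq_div_le`). Hence `p_* / p_{G,σ_*}` has mean at most `exp(D δ² / σ_*²)` under `p_*`,
which is an exponential-moment bound (`measure_le_sum_log_approx_le`).

*Estimation.* A Gaussian density is dominated by a multiple, with factor close to `1`, of a nearby
Gaussian density with a slightly larger variance (`gaussianDensity_le_mul`). So each cell of a cover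
of `F × [σmin, σmax]` has an upper bracket `(1 + γ) p_{g',s}`, and no truncation of the tails is
needed. The affinity of such a bracket with `p_*` is at most `1 - ε² / 2` plus a term of order `√γ`
(`integral_sqrt_mul_le`), which bounds the probability of the cell (`measure_cell_le`). As the
metric entropy grows only logarithmically in the radius, one can afford cells so small that
`√γ ≤ 1 / (8 n) ≤ ε² / 8`; the logarithm of their number is still a multiple of
`ξ (A + log (n / σmin)) ≲ n ε²` (`card_cells_le`), and a plain union bound suffices, without
chaining.
-/

namespace CondGen

/-! ### Gaussian densities -/

section Gaussian

variable {D : ℕ} {σ : ℝ}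

lemma gaussianDensity_pos (hσ : 0 < σ) (v : Fin D → ℝ) : 0 < gaussianDensity σ v := by
  unfold gaussianDensity; positivity

lemma continuous_gaussianDensity (σ : ℝ) :
    Continuous (gaussianDensity σ : (Fin D → ℝ) → ℝ) := by
  unfold gaussianDensity; fun_prop

lemma gaussianDensity_le (hσ : 0 < σ) (v : Fin D → ℝ) :
    gaussianDensity σ v ≤ (2 * Real.pi * σ ^ 2) ^ (-(D : ℝ) / 2) := by
  unfold gaussianDensity
  refine mul_le_of_le_one_right (by positivity) (Real.exp_le_one_iff.2 ?_)
  have : 0 ≤ ∑ i, v i ^ 2 := Finset.sum_nonneg fun i _ => sq_nonneg _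
  exact div_nonpos_of_nonpos_of_nonneg (by linarith) (by positivity)

lemma gaussianDensity_eq_prod (hσ : 0 < σ) (v : Fin D → ℝ) :
    gaussianDensity σ v = ∏ i, gaussianPDFReal 0 (σ ^ 2).toNNReal (v i) := by
  have hσ2 : ((σ ^ 2).toNNReal : ℝ) = σ ^ 2 := Real.coe_toNNReal _ (by positivity)
  have hp : (0 : ℝ) < 2 * Real.pi * σ ^ 2 := by positivity
  simp only [gaussianPDFReal, hσ2, Finset.prod_mul_distrib, ← Real.exp_sum, sub_zero,
    Finset.prod_const, Finset.card_univ, Fintype.card_fin, gaussianDensity]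
  congr 1
  · rw [Real.sqrt_eq_rpow, ← Real.rpow_neg hp.le, ← Real.rpow_mul_natCast hp.le]
    congr 1; ring
  · rw [← Finset.sum_div, Finset.sum_neg_distrib]

lemma integrable_gaussianDensity (hσ : 0 < σ) :
    Integrable (gaussianDensity σ : (Fin D → ℝ) → ℝ) := by
  have : (gaussianDensity σ : (Fin D → ℝ) → ℝ) =
      fun v => ∏ i, gaussianPDFReal 0 (σ ^ 2).toNNReal (v i) :=
    funext (gaussianDensity_eq_prod hσ)
  rw [this]
  exact Integrable.fintype_prod fun _ => integrable_gaussianPDFReal _ _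

lemma integral_gaussianDensity (hσ : 0 < σ) :
    ∫ v : Fin D → ℝ, gaussianDensity σ v = 1 := by
  have h : (σ ^ 2).toNNReal ≠ 0 := (Real.toNNReal_pos.2 (by positivity)).ne'
  simp_rw [gaussianDensity_eq_prod hσ]
  rw [integral_fintype_prod_volume_eq_pow, integral_gaussianPDFReal_eq_one _ h, one_pow]

lemma lintegral_gaussianDensity_sub (hσ : 0 < σ) (a : Fin D → ℝ) :
    ∫⁻ y, ENNReal.ofReal (gaussianDensity σ (y - a)) = 1 := by
  rw [lintegral_sub_right_eq_self (fun v => ENNReal.ofReal (gaussianDensity σ v)) a,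
    ← ofReal_integral_eq_lintegral_ofReal (integrable_gaussianDensity hσ)
      (ae_of_all _ fun v => (gaussianDensity_pos hσ v).le),
    integral_gaussianDensity hσ, ENNReal.ofReal_one]

/-- Shifting the centre by at most `δ` in each coordinate and inflating the standard deviation from
`σ` to `s` costs a factor close to `1`. It follows from
`|v|² ≥ |w|² / (1 + θ) - |v - w|² / θ`. -/
lemma gaussianDensity_le_mul {s θ δ : ℝ} (hσ : 0 < σ) (hθ : 0 < θ) (hs : σ * (1 + θ) ≤ s)
    {v w : Fin D → ℝ} (hvw : ‖v - w‖ ≤ δ) :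
    gaussianDensity σ v ≤
      (s / σ) ^ D * Real.exp (D * δ ^ 2 / (2 * σ ^ 2 * θ)) * gaussianDensity s w := by
  have hs0 : 0 < s := lt_of_lt_of_le (by positivity) hs
  have hp : (0 : ℝ) < 2 * Real.pi := by positivity
  have hnorm : (2 * Real.pi * σ ^ 2) ^ (-(D : ℝ) / 2) =
      (s / σ) ^ D * (2 * Real.pi * s ^ 2) ^ (-(D : ℝ) / 2) := by
    have key : ∀ t : ℝ, 0 < t → (t ^ 2) ^ (-(D : ℝ) / 2) = (t ^ D)⁻¹ := fun t ht => by
      rw [← Real.rpow_natCast t 2, ← Real.rpow_mul ht.le, ← Real.rpow_natCast t D,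
        ← Real.rpow_neg ht.le]
      congr 1; push_cast; ring
    rw [Real.mul_rpow hp.le (by positivity), Real.mul_rpow hp.le (by positivity), key σ hσ,
      key s hs0, div_pow]
    have : s ^ D ≠ 0 := by positivity
    field_simp
  have hexp : -(∑ i, v i ^ 2) / (2 * σ ^ 2) ≤
      D * δ ^ 2 / (2 * σ ^ 2 * θ) + -(∑ i, w i ^ 2) / (2 * s ^ 2) := by
    have hδ : 0 ≤ δ := (norm_nonneg _).trans hvw
    have hi : ∀ i, w i ^ 2 / (2 * s ^ 2) ≤ v i ^ 2 / (2 * σ ^ 2) + δ ^ 2 / (2 * σ ^ 2 * θ) := by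
      intro i
      have h1 : (w i - v i) ^ 2 ≤ δ ^ 2 := by
        rw [sq_le_sq, abs_of_nonneg hδ, abs_sub_comm]
        exact (norm_le_pi_norm (v - w) i).trans hvw
      have h2 : w i ^ 2 ≤ (1 + θ) * v i ^ 2 + (1 + θ) / θ * δ ^ 2 := by
        have h3 : w i ^ 2 ≤ (1 + θ) * v i ^ 2 + (1 + θ) / θ * (w i - v i) ^ 2 := by
          have : (1 + θ) * v i ^ 2 + (1 + θ) / θ * (w i - v i) ^ 2 - w i ^ 2 =
              (θ * v i - (w i - v i)) ^ 2 / θ := by field_simp; ring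
          have : 0 ≤ (θ * v i - (w i - v i)) ^ 2 / θ := by positivity
          linarith
        have := mul_le_mul_of_nonneg_left h1 (by positivity : 0 ≤ (1 + θ) / θ)
        linarith
      have h4 : σ ^ 2 * (1 + θ) ≤ s ^ 2 := by
        have : (σ * (1 + θ)) ^ 2 ≤ s ^ 2 := pow_le_pow_left₀ (by positivity) hs 2
        nlinarith [mul_pos (pow_pos hσ 2) hθ, mul_pos (pow_pos hσ 2) (mul_pos hθ hθ)]
      calc w i ^ 2 / (2 * s ^ 2) ≤ w i ^ 2 / (2 * (σ ^ 2 * (1 + θ))) := by gcongr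
        _ ≤ ((1 + θ) * v i ^ 2 + (1 + θ) / θ * δ ^ 2) / (2 * (σ ^ 2 * (1 + θ))) := by gcongr
        _ = _ := by field_simp
    have hsum := Finset.sum_le_sum fun i (_ : i ∈ Finset.univ) => hi i
    rw [Finset.sum_add_distrib, ← Finset.sum_div, ← Finset.sum_div, Finset.sum_const,
      Finset.card_univ, Fintype.card_fin, nsmul_eq_mul] at hsum
    rw [neg_div, neg_div, mul_div_assoc]
    linarith
  unfold gaussianDensity
  rw [hnorm, mul_mul_mul_comm, ← Real.exp_add]
  gcongr

/-- `φ_σ(y - a)² / φ_σ(y - b) = exp(|a - b|² / σ²) φ_σ(y - (2a - b))`, by completing the square. -/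
lemma gaussianDensity_sq_le {δ : ℝ} (hσ : 0 < σ) {a b : Fin D → ℝ} (hab : ‖b - a‖ ≤ δ)
    (y : Fin D → ℝ) :
    gaussianDensity σ (y - a) ^ 2 ≤ gaussianDensity σ (y - b) *
      (Real.exp (D * (δ / σ) ^ 2) * gaussianDensity σ (y - ((2 : ℝ) • a - b))) := by
  have hδ : 0 ≤ δ := (norm_nonneg _).trans hab
  have hi : ∀ i, (y i - b i) ^ 2 + (y i - (2 * a i - b i)) ^ 2 ≤
      2 * (y i - a i) ^ 2 + 2 * δ ^ 2 := by
    intro i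
    have h1 : (b i - a i) ^ 2 ≤ δ ^ 2 := by
      rw [sq_le_sq, abs_of_nonneg hδ]
      exact (norm_le_pi_norm (b - a) i).trans hab
    nlinarith
  have hsum := Finset.sum_le_sum fun i (_ : i ∈ Finset.univ) => hi i
  simp only [Finset.sum_add_distrib, ← Finset.mul_sum, Finset.sum_const, Finset.card_univ,
    Fintype.card_fin, nsmul_eq_mul] at hsum
  unfold gaussianDensity
  simp only [Pi.sub_apply, Pi.smul_apply, smul_eq_mul]
  generalize (2 * Real.pi * σ ^ 2) ^ (-(D : ℝ) / 2) = c
  have hexp : Real.exp (-(∑ i, (y i - a i) ^ 2) / (2 * σ ^ 2)) ^ 2 ≤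
      Real.exp (D * (δ / σ) ^ 2 + -(∑ i, (y i - b i) ^ 2) / (2 * σ ^ 2) +
        -(∑ i, (y i - (2 * a i - b i)) ^ 2) / (2 * σ ^ 2)) := by
    rw [← Real.exp_nat_mul]
    refine Real.exp_le_exp.2 ?_
    have h := div_le_div_of_nonneg_right hsum (by positivity : (0 : ℝ) ≤ 2 * σ ^ 2)
    rw [add_div, add_div] at h
    have e1 : 2 * (D * δ ^ 2) / (2 * σ ^ 2) = D * (δ / σ) ^ 2 := by field_simp
    have e2 : 2 * (∑ i, (y i - a i) ^ 2) / (2 * σ ^ 2) =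
        2 * ((∑ i, (y i - a i) ^ 2) / (2 * σ ^ 2)) := mul_div_assoc _ _ _
    rw [e1, e2] at h
    simp only [neg_div, Nat.cast_ofNat]
    linarith
  rw [Real.exp_add, Real.exp_add] at hexp
  rw [mul_pow]
  refine (mul_le_mul_of_nonneg_left hexp (sq_nonneg c)).trans_eq ?_
  ring

end Gaussian

/-! ### Mixture densities -/

section Model

variable {Z X : Type*} [MeasurableSpace Z] [MeasurableSpace X] {D : ℕ} {PZ : Measure Z}
  [IsProbabilityMeasure PZ] {g g' : Z × X → Fin D → ℝ} {σ : ℝ}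

lemma integrable_gaussianDensity_sub (hσ : 0 < σ) (hg : Measurable g) (x : X) (y : Fin D → ℝ) :
    Integrable (fun z => gaussianDensity σ (y - g (z, x))) PZ := by
  refine Integrable.of_bound (C := (2 * Real.pi * σ ^ 2) ^ (-(D : ℝ) / 2))
    ((continuous_gaussianDensity σ).measurable.comp (by fun_prop)).aestronglyMeasurable
    (ae_of_all _ fun z => ?_)
  rw [Real.norm_of_nonneg (gaussianDensity_pos hσ _).le]
  exact gaussianDensity_le hσ _

lemma condDensity_pos (hσ : 0 < σ) (hg : Measurable g) (x : X) (y : Fin D → ℝ) :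
    0 < condDensity PZ g σ x y := by
  have hpos := fun z => gaussianDensity_pos hσ (y - g (z, x))
  refine (integral_pos_iff_support_of_nonneg (fun z => (hpos z).le)
    (integrable_gaussianDensity_sub hσ hg x y)).2 ?_
  rw [Function.support_eq_univ fun z => (hpos z).ne']
  simp

lemma measurable_condDensity (hg : Measurable g) :
    Measurable fun w : X × (Fin D → ℝ) => condDensity PZ g σ w.1 w.2 := by
  have hm : Measurable fun q : (X × (Fin D → ℝ)) × Z =>
      gaussianDensity σ (q.1.2 - g (q.2, q.1.1)) :=
    (continuous_gaussianDensity σ).measurable.comp (by fun_prop)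
  exact hm.stronglyMeasurable.integral_prod_right'.measurable

lemma lintegral_condDensity (hσ : 0 < σ) (hg : Measurable g) (x : X) :
    ∫⁻ y, ENNReal.ofReal (condDensity PZ g σ x y) = 1 := by
  have hm : Measurable fun q : (Fin D → ℝ) × Z =>
      ENNReal.ofReal (gaussianDensity σ (q.1 - g (q.2, x))) :=
    ((continuous_gaussianDensity σ).measurable.comp (by fun_prop)).ennreal_ofReal
  have h : ∀ y, ENNReal.ofReal (condDensity PZ g σ x y) =
      ∫⁻ z, ENNReal.ofReal (gaussianDensity σ (y - g (z, x))) ∂PZ := fun y =>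
    ofReal_integral_eq_lintegral_ofReal (integrable_gaussianDensity_sub hσ hg x y)
      (ae_of_all _ fun z => (gaussianDensity_pos hσ _).le)
  simp_rw [h]
  rw [lintegral_lintegral_swap hm.aemeasurable]
  simp [lintegral_gaussianDensity_sub hσ]

lemma integrable_condDensity (hσ : 0 < σ) (hg : Measurable g) (x : X) :
    Integrable (condDensity PZ g σ x) := by
  refine (lintegral_ofReal_ne_top_iff_integrable
    ((measurable_condDensity hg).comp measurable_prodMk_left).aestronglyMeasurable
    (ae_of_all _ fun y => (condDensity_pos hσ hg x y).le)).1 ?_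
  change ∫⁻ y, ENNReal.ofReal (condDensity PZ g σ x y) ≠ ⊤
  simp [lintegral_condDensity hσ hg x]

lemma integral_condDensity (hσ : 0 < σ) (hg : Measurable g) (x : X) :
    ∫ y, condDensity PZ g σ x y = 1 := by
  rw [integral_eq_lintegral_of_nonneg_ae (ae_of_all _ fun y => (condDensity_pos hσ hg x y).le)
    (integrable_condDensity hσ hg x).aestronglyMeasurable, lintegral_condDensity hσ hg x]
  simp

/-- The multiplicative upper bracket: a multiple of one mixture density dominates every
`p_{g,σ}` with `g` near `g'` and `σ` slightly below `s`. -/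
lemma condDensity_le_mul {s θ δ : ℝ} (hσ : 0 < σ) (hθ : 0 < θ) (hs : σ * (1 + θ) ≤ s)
    (hg : Measurable g) (hg' : Measurable g') (h : ∀ w, ‖g w - g' w‖ ≤ δ)
    (x : X) (y : Fin D → ℝ) :
    condDensity PZ g σ x y ≤ (s / σ) ^ D * Real.exp (D * δ ^ 2 / (2 * σ ^ 2 * θ)) *
      condDensity PZ g' s x y := by
  have hs0 : 0 < s := lt_of_lt_of_le (by positivity) hs
  unfold condDensity
  rw [← integral_const_mul]
  refine integral_mono (integrable_gaussianDensity_sub hσ hg x y)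
    ((integrable_gaussianDensity_sub hs0 hg' x y).const_mul _) fun z =>
      gaussianDensity_le_mul hσ hθ hs ?_
  rw [sub_sub_sub_cancel_left, ← norm_neg, neg_sub]
  exact h (z, x)

/-- `p² / q ≤ exp(D δ² / σ²) r` for the mixtures `p`, `q`, `r` with generators `g`, `g'` and
`2g - g'`. With `c = p / q`, integrating `2 c φ_g ≤ c² φ_{g'} + φ_g² / φ_{g'}` over the latent
variable gives `2 p² / q ≤ p² / q + ∫ φ_g² / φ_{g'}`. -/
lemma condDensity_sq_div_le {δ : ℝ} (hσ : 0 < σ)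
    (hg : Measurable g) (hg' : Measurable g') (h : ∀ w, ‖g' w - g w‖ ≤ δ)
    (x : X) (y : Fin D → ℝ) :
    condDensity PZ g σ x y ^ 2 / condDensity PZ g' σ x y ≤ Real.exp (D * (δ / σ) ^ 2) *
      condDensity PZ (fun w => (2 : ℝ) • g w - g' w) σ x y := by
  set p := condDensity PZ g σ x y
  set q := condDensity PZ g' σ x y with hq_def
  have hq : 0 < q := condDensity_pos hσ hg' x y
  set c := p / q with hc
  have hr : Measurable fun w => (2 : ℝ) • g w - g' w := by fun_prop
  have key : 2 * c * p ≤ c ^ 2 * q + Real.exp (D * (δ / σ) ^ 2) *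
      condDensity PZ (fun w => (2 : ℝ) • g w - g' w) σ x y := by
    simp only [p, hq_def, condDensity]
    rw [← integral_const_mul, ← integral_const_mul, ← integral_const_mul, ← integral_add
      ((integrable_gaussianDensity_sub hσ hg' x y).const_mul _)
      ((integrable_gaussianDensity_sub hσ hr x y).const_mul _)]
    refine integral_mono ((integrable_gaussianDensity_sub hσ hg x y).const_mul _)
      (((integrable_gaussianDensity_sub hσ hg' x y).const_mul _).add
        ((integrable_gaussianDensity_sub hσ hr x y).const_mul _)) fun z => ?_
    have h1 := gaussianDensity_sq_le hσ (h (z, x)) y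
    have h2 := gaussianDensity_pos hσ (y - g' (z, x))
    simp only
    refine le_of_mul_le_mul_left ?_ h2
    nlinarith [sq_nonneg (c * gaussianDensity σ (y - g' (z, x)) -
      gaussianDensity σ (y - g (z, x)))]
  have h1 : c * p = p ^ 2 / q := by rw [hc]; ring
  have h2 : c ^ 2 * q = p ^ 2 / q := by rw [hc]; field_simp
  linarith

end Model

/-! ### Affinity of upper brackets -/

section Hellinger

variable {D : ℕ}

/-- The affinity with `q` of an upper bracket `u` of `p`, in terms of the Hellinger distance of `p`
and `q` and the excess mass `γ` of `u`. The square of the distance is replaced by its tangent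
`2 ε h - ε²`, which is linear in `h` and so can be averaged over the predictor. -/
lemma integral_sqrt_mul_le {p q u : (Fin D → ℝ) → ℝ} {γ c : ℝ} (ε : ℝ) (hp : Integrable p)
    (hq : Integrable q) (hu : Integrable u) (hp0 : ∀ y, 0 ≤ p y) (hq0 : ∀ y, 0 ≤ q y)
    (hpu : ∀ y, p y ≤ u y) (hp1 : ∫ y, p y = 1) (hq1 : ∫ y, q y = 1) (hu1 : ∫ y, u y ≤ 1 + γ)
    (hc : 0 < c) :
    Integrable (fun y => Real.sqrt (u y * q y)) ∧ ∫ y, Real.sqrt (u y * q y) ≤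
      1 + ε ^ 2 / 2 - ε * hellinger p q + (c * γ + c⁻¹) / 2 := by
  have hh : Integrable fun y => (Real.sqrt (p y) - Real.sqrt (q y)) ^ 2 := by
    refine (hp.add hq).mono' ?_ (ae_of_all _ fun y => ?_)
    · exact ((Real.continuous_sqrt.comp_aestronglyMeasurable hp.aestronglyMeasurable).sub
        (Real.continuous_sqrt.comp_aestronglyMeasurable hq.aestronglyMeasurable)).pow 2
    · rw [Real.norm_of_nonneg (sq_nonneg _), sub_sq, Real.sq_sqrt (hp0 y), Real.sq_sqrt (hq0 y),
        Pi.add_apply]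
      have := mul_nonneg (Real.sqrt_nonneg (p y)) (Real.sqrt_nonneg (q y))
      linarith
  have hpq : Integrable fun y => p y + q y := hp.add hq
  have hup : Integrable fun y => c * (u y - p y) := (hu.sub hp).const_mul c
  have hqc : Integrable fun y => c⁻¹ * q y := hq.const_mul c⁻¹
  have hint₁ : Integrable fun y => (p y + q y - (Real.sqrt (p y) - Real.sqrt (q y)) ^ 2) / 2 :=
    (hpq.sub hh).div_const 2
  have hint₂ : Integrable fun y => (c * (u y - p y) + c⁻¹ * q y) / 2 := (hup.add hqc).div_const 2
  have hle : ∀ y, Real.sqrt (u y * q y) ≤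
      (p y + q y - (Real.sqrt (p y) - Real.sqrt (q y)) ^ 2) / 2 +
        (c * (u y - p y) + c⁻¹ * q y) / 2 := by
    intro y
    have hup : 0 ≤ u y - p y := sub_nonneg.2 (hpu y)
    have h1 : Real.sqrt (u y) ≤ Real.sqrt (p y) + Real.sqrt (u y - p y) := by
      refine Real.sqrt_le_iff.2 ⟨by positivity, ?_⟩
      rw [add_sq, Real.sq_sqrt (hp0 y), Real.sq_sqrt hup]
      have := mul_nonneg (Real.sqrt_nonneg (p y)) (Real.sqrt_nonneg (u y - p y))
      linarith
    have h2 : Real.sqrt (u y - p y) * Real.sqrt (q y) ≤ (c * (u y - p y) + c⁻¹ * q y) / 2 := by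
      have h3 : 0 ≤ c⁻¹ * (c * Real.sqrt (u y - p y) - Real.sqrt (q y)) ^ 2 := by positivity
      have h4 : c⁻¹ * (c * Real.sqrt (u y - p y) - Real.sqrt (q y)) ^ 2 =
          c * Real.sqrt (u y - p y) ^ 2 + c⁻¹ * Real.sqrt (q y) ^ 2 -
            2 * (Real.sqrt (u y - p y) * Real.sqrt (q y)) := by field_simp; ring
      rw [h4, Real.sq_sqrt hup, Real.sq_sqrt (hq0 y)] at h3
      linarith
    rw [Real.sqrt_mul ((hp0 y).trans (hpu y)), sub_sq, Real.sq_sqrt (hp0 y), Real.sq_sqrt (hq0 y)]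
    have := mul_le_mul_of_nonneg_right h1 (Real.sqrt_nonneg (q y))
    linarith
  have hint : Integrable fun y => Real.sqrt (u y * q y) := by
    refine (hint₁.add hint₂).mono' (Real.continuous_sqrt.comp_aestronglyMeasurable
      (hu.aestronglyMeasurable.mul hq.aestronglyMeasurable)) (ae_of_all _ fun y => ?_)
    rw [Real.norm_of_nonneg (Real.sqrt_nonneg _)]
    exact hle y
  refine ⟨hint, (integral_mono hint (hint₁.add hint₂) hle).trans ?_⟩
  have hsq : hellinger p q ^ 2 = ∫ y, (Real.sqrt (p y) - Real.sqrt (q y)) ^ 2 :=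
    Real.sq_sqrt (integral_nonneg fun y => sq_nonneg _)
  rw [integral_add' hint₁ hint₂, integral_div, integral_div, integral_sub hpq hh,
    integral_add hp hq, integral_add hup hqc, integral_const_mul, integral_const_mul,
    integral_sub hu hp, hp1, hq1, ← hsq]
  nlinarith [sq_nonneg (hellinger p q - ε), mul_le_mul_of_nonneg_left hu1 hc.le]

end Hellinger

/-! ### Integrals and tail bounds under the sampling law -/

section Sample

variable {X : Type*} [MeasurableSpace X] {D : ℕ}

lemma lintegral_pairLaw {μ : Measure X} [SFinite μ] {p : X → (Fin D → ℝ) → ℝ}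
    (hp : Measurable fun w : X × (Fin D → ℝ) => p w.1 w.2) {f : X × (Fin D → ℝ) → ENNReal}
    (hf : Measurable f) :
    ∫⁻ w, f w ∂pairLaw μ p = ∫⁻ x, (∫⁻ y, ENNReal.ofReal (p x y) * f (x, y)) ∂μ := by
  rw [pairLaw, lintegral_withDensity_eq_lintegral_mul _ hp.ennreal_ofReal hf,
    lintegral_prod _ (hp.ennreal_ofReal.mul hf).aemeasurable]
  rfl

/-- The Chernoff bound for a sum over an i.i.d. sample. -/
lemma measure_le_sum_le_exp {Ω E : Type*} [MeasurableSpace Ω] [MeasurableSpace E]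
    {P : Measure Ω} {Q : Measure E} [IsProbabilityMeasure Q] {n : ℕ} {W : Fin n → Ω → E}
    (hind : iIndepFun W P) (hlaw : ∀ i, HasLaw (W i) Q P) {f : E → ℝ} (hf : Measurable f)
    {c : ℝ} (hc : ∫⁻ w, ENNReal.ofReal (Real.exp (f w)) ∂Q ≤ ENNReal.ofReal (Real.exp c))
    (t : ℝ) :
    P {ω | t ≤ ∑ i, f (W i ω)} ≤ ENNReal.ofReal (Real.exp (n * c - t)) := by
  have hjoint : HasLaw (fun ω i => W i ω) (Measure.pi fun _ : Fin n => Q) P :=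
    hind.hasLaw_pi hlaw
  have hF : Measurable fun w : Fin n → E => ∏ i, ENNReal.ofReal (Real.exp (f (w i))) := by
    fun_prop
  have hprod : ∫⁻ w, ∏ i, ENNReal.ofReal (Real.exp (f (w i))) ∂(Measure.pi fun _ : Fin n => Q) =
      (∫⁻ w, ENNReal.ofReal (Real.exp (f w)) ∂Q) ^ n := by
    rw [lintegral_prod_eq_prod_lintegral_of_indepFun Finset.univ
      (fun i (w : Fin n → E) => ENNReal.ofReal (Real.exp (f (w i))))
      (iIndepFun_pi (X := fun (_ : Fin n) w => ENNReal.ofReal (Real.exp (f w)))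
        fun i => by fun_prop) (fun i => by fun_prop)]
    have : ∀ i : Fin n, ∫⁻ w, ENNReal.ofReal (Real.exp (f (w i))) ∂(Measure.pi fun _ : Fin n => Q)
        = ∫⁻ w, ENNReal.ofReal (Real.exp (f w)) ∂Q := fun i =>
      (measurePreserving_eval (fun _ : Fin n => Q) i).lintegral_comp
        (f := fun w => ENNReal.ofReal (Real.exp (f w))) (by fun_prop)
    simp [this]
  have hset : {ω | t ≤ ∑ i, f (W i ω)} ⊆
      {ω | ENNReal.ofReal (Real.exp t) ≤ ∏ i, ENNReal.ofReal (Real.exp (f (W i ω)))} := by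
    intro ω hω
    simp only [Set.mem_ofPred_eq] at hω ⊢
    rw [← ENNReal.ofReal_prod_of_nonneg fun i _ => (Real.exp_pos _).le, ← Real.exp_sum]
    exact ENNReal.ofReal_le_ofReal (Real.exp_le_exp.2 hω)
  have hpos : ENNReal.ofReal (Real.exp t) ≠ 0 := by simp [Real.exp_pos]
  refine (measure_mono hset).trans ((meas_ge_le_lintegral_div
    (hF.comp_aemeasurable hjoint.aemeasurable) hpos ENNReal.ofReal_ne_top).trans ?_)
  have hcomp := hjoint.lintegral_comp (f := fun w => ∏ i, ENNReal.ofReal (Real.exp (f (w i))))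
    hF.aemeasurable
  refine (ENNReal.div_le_div_right
    (hcomp.trans_le (hprod.trans_le (pow_le_pow_left' hc n))) _).trans_eq ?_
  rw [← ENNReal.ofReal_pow (Real.exp_pos _).le, ← ENNReal.ofReal_div_of_pos (Real.exp_pos _),
    ← Real.exp_nat_mul, Real.exp_sub]

end Sample

/-! ### Likelihood ratios -/

section LikelihoodRatio

variable {Z X : Type*} [MeasurableSpace Z] [MeasurableSpace X] {D : ℕ} {PZ : Measure Z}
  [IsProbabilityMeasure PZ] {μ : Measure X} [IsProbabilityMeasure μ] {σs : ℝ}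
  {Gs : Z × X → Fin D → ℝ}

lemma isProbabilityMeasure_pairLaw (hσs : 0 < σs) (hGs : Measurable Gs) :
    IsProbabilityMeasure (pairLaw μ (condDensity PZ Gs σs)) := by
  constructor
  have := lintegral_pairLaw (μ := μ) (measurable_condDensity (PZ := PZ) (σ := σs) hGs)
    (f := fun _ => 1) measurable_const
  simpa [lintegral_condDensity hσs hGs] using this

variable {Ω : Type*} [MeasurableSpace Ω] {P : Measure Ω} {n : ℕ}
  {W : Fin n → Ω → X × (Fin D → ℝ)}

/-- The log-likelihood loss of the approximating generator has exponential tails: the first moment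
of `p_* / p_{G,σ_*}` under `p_*` is at most `exp(D δ² / σ_*²)`. -/
lemma measure_le_sum_log_approx_le (hσs : 0 < σs) (hGs : Measurable Gs)
    {G : Z × X → Fin D → ℝ} (hG : Measurable G) {δ : ℝ} (h : ∀ w, ‖G w - Gs w‖ ≤ δ)
    (hind : iIndepFun W P) (hlaw : ∀ i, HasLaw (W i) (pairLaw μ (condDensity PZ Gs σs)) P)
    (t : ℝ) :
    P {ω | t ≤ ∑ i, (Real.log (condDensity PZ Gs σs (W i ω).1 (W i ω).2) -
        Real.log (condDensity PZ G σs (W i ω).1 (W i ω).2))} ≤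
      ENNReal.ofReal (Real.exp (n * (D * (δ / σs) ^ 2) - t)) := by
  have := isProbabilityMeasure_pairLaw (PZ := PZ) (μ := μ) hσs hGs
  have hms := measurable_condDensity (PZ := PZ) (σ := σs) hGs
  have hm := measurable_condDensity (PZ := PZ) (σ := σs) hG
  have hr : Measurable fun w => (2 : ℝ) • Gs w - G w := by fun_prop
  refine measure_le_sum_le_exp hind hlaw (f := fun w =>
    Real.log (condDensity PZ Gs σs w.1 w.2) - Real.log (condDensity PZ G σs w.1 w.2))
    (hms.log.sub hm.log) ?_ t
  rw [lintegral_pairLaw hms (by fun_prop)]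
  have hle : ∀ x y, ENNReal.ofReal (condDensity PZ Gs σs x y) *
      ENNReal.ofReal (Real.exp (Real.log (condDensity PZ Gs σs x y) -
        Real.log (condDensity PZ G σs x y))) ≤
      ENNReal.ofReal (Real.exp (D * (δ / σs) ^ 2)) *
        ENNReal.ofReal (condDensity PZ (fun w => (2 : ℝ) • Gs w - G w) σs x y) := by
    intro x y
    have hp := condDensity_pos (PZ := PZ) hσs hGs x y
    have hq := condDensity_pos (PZ := PZ) hσs hG x y
    rw [Real.exp_sub, Real.exp_log hp, Real.exp_log hq, ← ENNReal.ofReal_mul hp.le,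
      ← ENNReal.ofReal_mul (Real.exp_pos _).le, ← mul_div_assoc, ← sq]
    exact ENNReal.ofReal_le_ofReal (condDensity_sq_div_le hσs hGs hG h x y)
  calc _ ≤ ∫⁻ x, (∫⁻ y, ENNReal.ofReal (Real.exp (D * (δ / σs) ^ 2)) *
        ENNReal.ofReal (condDensity PZ (fun w => (2 : ℝ) • Gs w - G w) σs x y)) ∂μ :=
        lintegral_mono fun x => lintegral_mono fun y => hle x y
    _ = _ := by
      simp_rw [lintegral_const_mul' _ _ ENNReal.ofReal_ne_top, lintegral_condDensity hσs hr]
      simp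

/-- The likelihood ratio of an upper bracket of a density at distance more than `ε` from the truth
is exponentially small. -/
lemma measure_le_sum_log_bracket_le (hσs : 0 < σs) (hGs : Measurable Gs)
    {g g' : Z × X → Fin D → ℝ} (hg : Measurable g) (hg' : Measurable g') {σ s γ c ε : ℝ}
    (hσ : 0 < σ) (hs : 0 < s) (hγ : 0 ≤ γ) (hc : 0 < c) (hε : 0 < ε)
    (hbr : ∀ x y, condDensity PZ g σ x y ≤ (1 + γ) * condDensity PZ g' s x y)
    (hfar : ε < integratedHellinger μ (condDensity PZ g σ) (condDensity PZ Gs σs))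
    (hind : iIndepFun W P) (hlaw : ∀ i, HasLaw (W i) (pairLaw μ (condDensity PZ Gs σs)) P)
    (t : ℝ) :
    P {ω | t ≤ ∑ i, (Real.log ((1 + γ) * condDensity PZ g' s (W i ω).1 (W i ω).2) -
        Real.log (condDensity PZ Gs σs (W i ω).1 (W i ω).2))} ≤
      ENNReal.ofReal (Real.exp (n * (-(ε ^ 2 / 2) + (c * γ + c⁻¹) / 2) - t / 2)) := by
  have := isProbabilityMeasure_pairLaw (PZ := PZ) (μ := μ) hσs hGs
  have hms := measurable_condDensity (PZ := PZ) (σ := σs) hGs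
  have hm := measurable_condDensity (PZ := PZ) (σ := s) hg'
  set κ := (c * γ + c⁻¹) / 2
  have hset : {ω | t ≤ ∑ i, (Real.log ((1 + γ) * condDensity PZ g' s (W i ω).1 (W i ω).2) -
        Real.log (condDensity PZ Gs σs (W i ω).1 (W i ω).2))} =
      {ω | t / 2 ≤ ∑ i, (Real.log ((1 + γ) * condDensity PZ g' s (W i ω).1 (W i ω).2) -
        Real.log (condDensity PZ Gs σs (W i ω).1 (W i ω).2)) / 2} := by
    ext ω
    simp only [Set.mem_ofPred_eq, ← Finset.sum_div]
    rw [div_le_div_iff_of_pos_right two_pos]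
  rw [hset]
  refine measure_le_sum_le_exp hind hlaw (f := fun w =>
    (Real.log ((1 + γ) * condDensity PZ g' s w.1 w.2) -
      Real.log (condDensity PZ Gs σs w.1 w.2)) / 2)
    (((hm.const_mul _).log.sub hms.log).div_const 2) ?_ (t / 2)
  rw [lintegral_pairLaw hms (by fun_prop)]
  have hsqrt : ∀ x y, ENNReal.ofReal (condDensity PZ Gs σs x y) * ENNReal.ofReal (Real.exp
      ((Real.log ((1 + γ) * condDensity PZ g' s x y) - Real.log (condDensity PZ Gs σs x y)) / 2)) =
      ENNReal.ofReal (Real.sqrt ((1 + γ) * condDensity PZ g' s x y * condDensity PZ Gs σs x y)) := by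
    intro x y
    have hp := condDensity_pos (PZ := PZ) hσs hGs x y
    have hq : 0 < (1 + γ) * condDensity PZ g' s x y :=
      mul_pos (by linarith) (condDensity_pos (PZ := PZ) hs hg' x y)
    rw [← ENNReal.ofReal_mul hp.le, Real.exp_half, Real.exp_sub, Real.exp_log hp, Real.exp_log hq,
      Real.sqrt_div hq.le, Real.sqrt_mul hq.le]
    have h1 := Real.mul_self_sqrt hp.le
    have h2 := Real.sqrt_pos.2 hp
    congr 1
    field_simp
    rw [sq, h1]
  have haff := fun x => integral_sqrt_mul_le (γ := γ) ε (integrable_condDensity (PZ := PZ) hσ hg x)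
    (integrable_condDensity (PZ := PZ) hσs hGs x)
    ((integrable_condDensity (PZ := PZ) hs hg' x).const_mul (1 + γ))
    (fun y => (condDensity_pos hσ hg x y).le) (fun y => (condDensity_pos hσs hGs x y).le) (hbr x)
    (integral_condDensity hσ hg x) (integral_condDensity hσs hGs x)
    (by rw [integral_const_mul, integral_condDensity hs hg' x, mul_one]) hc
  -- a positive Bochner integral is the integral of an integrable function
  have hint : Integrable (fun x => hellinger (condDensity PZ g σ x) (condDensity PZ Gs σs x)) μ := by
    by_contra hni
    rw [integratedHellinger, integral_undef hni] at hfar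
    linarith
  have hint₁ : Integrable (fun x => 1 + ε ^ 2 / 2 -
      ε * hellinger (condDensity PZ g σ x) (condDensity PZ Gs σs x)) μ :=
    (integrable_const _).sub (hint.const_mul ε)
  have hint₂ : Integrable (fun x => 1 + ε ^ 2 / 2 -
      ε * hellinger (condDensity PZ g σ x) (condDensity PZ Gs σs x) + κ) μ :=
    hint₁.add (integrable_const κ)
  calc _ = ∫⁻ x, (∫⁻ y, ENNReal.ofReal
        (Real.sqrt ((1 + γ) * condDensity PZ g' s x y * condDensity PZ Gs σs x y))) ∂μ :=
        lintegral_congr fun x => lintegral_congr fun y => hsqrt x y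
    _ ≤ ∫⁻ x, ENNReal.ofReal (1 + ε ^ 2 / 2 -
          ε * hellinger (condDensity PZ g σ x) (condDensity PZ Gs σs x) + κ) ∂μ := by
        refine lintegral_mono fun x => ?_
        rw [← ofReal_integral_eq_lintegral_ofReal (haff x).1
          (ae_of_all _ fun y => Real.sqrt_nonneg _)]
        exact ENNReal.ofReal_le_ofReal (haff x).2
    _ = ENNReal.ofReal (1 + ε ^ 2 / 2 -
          ε * integratedHellinger μ (condDensity PZ g σ) (condDensity PZ Gs σs) + κ) := by
        rw [← ofReal_integral_eq_lintegral_ofReal hint₂ (ae_of_all _ fun x =>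
          (integral_nonneg fun y => Real.sqrt_nonneg _).trans (haff x).2),
          integral_add hint₁ (integrable_const κ),
          integral_sub (integrable_const _) (hint.const_mul ε), integral_const_mul]
        simp [integratedHellinger]
    _ ≤ _ := by
        refine ENNReal.ofReal_le_ofReal ?_
        have h1 := mul_le_mul_of_nonneg_left hfar.le hε.le
        have h2 := Real.add_one_le_exp (-(ε ^ 2 / 2) + κ)
        nlinarith

/-- One cell of the bracketing: generators within `a θ` of `g'` and standard deviations in
`[a, a (1 + θ)]`. -/
lemma measure_cell_le (hσs : 0 < σs) (hGs : Measurable Gs) (F : Set (Z × X → Fin D → ℝ))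
    (hF : ∀ g ∈ F, Measurable g) {g' : Z × X → Fin D → ℝ} (hg' : Measurable g')
    {a θ γ c ε : ℝ} (ha : 0 < a) (hθ : 0 < θ) (hγ : 6 * D * θ ≤ γ) (hγ1 : γ ≤ 1)
    (hc : 0 < c) (hε : 0 < ε)
    (hind : iIndepFun W P) (hlaw : ∀ i, HasLaw (W i) (pairLaw μ (condDensity PZ Gs σs)) P)
    (t : ℝ) :
    P {ω | ∃ g ∈ F, ∃ σ ∈ Set.Icc a (a * (1 + θ)), (∀ w, ‖g w - g' w‖ ≤ a * θ) ∧
        ε < integratedHellinger μ (condDensity PZ g σ) (condDensity PZ Gs σs) ∧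
        t ≤ ∑ i, (Real.log (condDensity PZ g σ (W i ω).1 (W i ω).2) -
          Real.log (condDensity PZ Gs σs (W i ω).1 (W i ω).2))} ≤
      ENNReal.ofReal (Real.exp (n * (-(ε ^ 2 / 2) + (c * γ + c⁻¹) / 2) - t / 2)) := by
  have hs : 0 < a * (1 + θ) * (1 + θ) := by positivity
  have hγ0 : 0 ≤ γ := le_trans (by positivity) hγ
  have hbr : ∀ g ∈ F, ∀ σ ∈ Set.Icc a (a * (1 + θ)), (∀ w, ‖g w - g' w‖ ≤ a * θ) → ∀ x y,
      condDensity PZ g σ x y ≤ (1 + γ) * condDensity PZ g' (a * (1 + θ) * (1 + θ)) x y := by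
    intro g hg σ hσ hd x y
    have hσ0 : 0 < σ := ha.trans_le hσ.1
    refine (condDensity_le_mul hσ0 hθ (mul_le_mul_of_nonneg_right hσ.2 (by positivity))
      (hF g hg) hg' hd x y).trans
      (mul_le_mul_of_nonneg_right ?_ (condDensity_pos hs hg' x y).le)
    have h1 : a * (1 + θ) * (1 + θ) / σ ≤ Real.exp (2 * θ) := by
      rw [div_le_iff₀ hσ0, two_mul, Real.exp_add]
      have h := Real.add_one_le_exp θ
      have h' : (1 + θ) * (1 + θ) ≤ Real.exp θ * Real.exp θ := by nlinarith
      calc a * (1 + θ) * (1 + θ) = (1 + θ) * (1 + θ) * a := by ring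
        _ ≤ Real.exp θ * Real.exp θ * σ := by gcongr; exact hσ.1
    have h2 : D * (a * θ) ^ 2 / (2 * σ ^ 2 * θ) ≤ D * θ := by
      rw [div_le_iff₀ (by positivity)]
      have h3 : a ^ 2 ≤ σ ^ 2 := pow_le_pow_left₀ ha.le hσ.1 2
      have h4 : (0 : ℝ) ≤ D * θ ^ 2 := by positivity
      nlinarith [mul_le_mul_of_nonneg_left h3 h4, mul_nonneg h4 (sq_nonneg a)]
    calc (a * (1 + θ) * (1 + θ) / σ) ^ D * Real.exp (D * (a * θ) ^ 2 / (2 * σ ^ 2 * θ))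
        ≤ Real.exp (2 * θ) ^ D * Real.exp (D * θ) := by gcongr
      _ = Real.exp (3 * D * θ) := by
        rw [← Real.exp_nat_mul, ← Real.exp_add]; congr 1; ring
      _ ≤ 1 + γ := by
        have h5 : |3 * D * θ| ≤ 1 := by rw [abs_of_nonneg (by positivity)]; linarith
        have h6 := Real.abs_exp_sub_one_le h5
        rw [abs_of_nonneg (by positivity : (0 : ℝ) ≤ 3 * D * θ)] at h6
        have := le_abs_self (Real.exp (3 * D * θ) - 1)
        linarith
  by_cases hex : ∃ g ∈ F, ∃ σ ∈ Set.Icc a (a * (1 + θ)), (∀ w, ‖g w - g' w‖ ≤ a * θ) ∧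
      ε < integratedHellinger μ (condDensity PZ g σ) (condDensity PZ Gs σs)
  · obtain ⟨g₀, hg₀, σ₀, hσ₀, hd₀, hfar₀⟩ := hex
    refine (measure_mono ?_).trans (measure_le_sum_log_bracket_le hσs hGs (hF g₀ hg₀) hg'
      (ha.trans_le hσ₀.1) hs hγ0 hc hε (hbr g₀ hg₀ σ₀ hσ₀ hd₀) hfar₀ hind hlaw t)
    rintro ω ⟨g, hg, σ, hσ, hd, -, ht⟩
    refine ht.trans (Finset.sum_le_sum fun i _ => sub_le_sub_right (Real.log_le_log
      (condDensity_pos (ha.trans_le hσ.1) (hF g hg) _ _) (hbr g hg σ hσ hd _ _)) _)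
  · refine (measure_mono (t := ∅) ?_).trans (by simp)
    rintro ω ⟨g, hg, σ, hσ, hd, hfar, -⟩
    exact hex ⟨g, hg, σ, hσ, hd, hfar⟩

/-- The union bound over the cells given by a finite cover `T` of the class and an arithmetic
progression of standard deviations. -/
lemma measure_exists_far_le (hσs : 0 < σs) (hGs : Measurable Gs) (F : Set (Z × X → Fin D → ℝ))
    (hF : ∀ g ∈ F, Measurable g) (T : Finset (Z × X → Fin D → ℝ)) (hT : ∀ g ∈ T, Measurable g)
    {σmin σmax θ γ c ε : ℝ} (hσmin : 0 < σmin) (hσmax : 0 ≤ σmax) (hθ : 0 < θ)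
    (hcover : ∀ g ∈ F, ∃ g' ∈ T, ∀ w, ‖g w - g' w‖ ≤ σmin * θ)
    (hγ : 6 * D * θ ≤ γ) (hγ1 : γ ≤ 1) (hc : 0 < c) (hε : 0 < ε)
    (hind : iIndepFun W P) (hlaw : ∀ i, HasLaw (W i) (pairLaw μ (condDensity PZ Gs σs)) P)
    (t : ℝ) :
    P {ω | ∃ g ∈ F, ∃ σ ∈ Set.Icc σmin σmax,
        ε < integratedHellinger μ (condDensity PZ g σ) (condDensity PZ Gs σs) ∧
        t ≤ ∑ i, (Real.log (condDensity PZ g σ (W i ω).1 (W i ω).2) -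
          Real.log (condDensity PZ Gs σs (W i ω).1 (W i ω).2))} ≤
      ENNReal.ofReal (T.card * (σmax / (σmin * θ) + 1) *
        Real.exp (n * (-(ε ^ 2 / 2) + (c * γ + c⁻¹) / 2) - t / 2)) := by
  set b := Real.exp (n * (-(ε ^ 2 / 2) + (c * γ + c⁻¹) / 2) - t / 2)
  set M := ⌊σmax / (σmin * θ)⌋₊
  have hsub : {ω | ∃ g ∈ F, ∃ σ ∈ Set.Icc σmin σmax,
        ε < integratedHellinger μ (condDensity PZ g σ) (condDensity PZ Gs σs) ∧
        t ≤ ∑ i, (Real.log (condDensity PZ g σ (W i ω).1 (W i ω).2) -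
          Real.log (condDensity PZ Gs σs (W i ω).1 (W i ω).2))} ⊆
      ⋃ q ∈ T ×ˢ Finset.range (M + 1), {ω | ∃ g ∈ F, ∃ σ ∈
        Set.Icc (σmin * (1 + q.2 * θ)) (σmin * (1 + q.2 * θ) * (1 + θ)),
        (∀ w, ‖g w - q.1 w‖ ≤ σmin * (1 + q.2 * θ) * θ) ∧
        ε < integratedHellinger μ (condDensity PZ g σ) (condDensity PZ Gs σs) ∧
        t ≤ ∑ i, (Real.log (condDensity PZ g σ (W i ω).1 (W i ω).2) -
          Real.log (condDensity PZ Gs σs (W i ω).1 (W i ω).2))} := by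
    rintro ω ⟨g, hg, σ, hσ, hfar, ht⟩
    obtain ⟨g', hg', hd⟩ := hcover g hg
    have hst : 0 < σmin * θ := by positivity
    have h0 : 0 ≤ (σ - σmin) / (σmin * θ) := div_nonneg (sub_nonneg.2 hσ.1) hst.le
    set k := ⌊(σ - σmin) / (σmin * θ)⌋₊
    have hk1 : k * (σmin * θ) ≤ σ - σmin := (le_div_iff₀ hst).1 (Nat.floor_le h0)
    have hk2 : σ - σmin < (k + 1) * (σmin * θ) := (div_lt_iff₀ hst).1 (Nat.lt_floor_add_one _)
    have hkM : k ≤ M := Nat.floor_le_floor (by gcongr; linarith [hσ.2])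
    have hkθ : (0 : ℝ) ≤ k * θ := by positivity
    refine Set.mem_biUnion (x := (g', k))
      (Finset.mem_product.2 ⟨hg', Finset.mem_range.2 (Nat.lt_succ_of_le hkM)⟩)
      ⟨g, hg, σ, ⟨?_, ?_⟩, fun w => (hd w).trans ?_, hfar, ht⟩
    · simp only; linarith
    · simp only
      nlinarith [mul_nonneg hst.le hkθ]
    · simp only
      nlinarith [mul_nonneg hst.le hkθ]
  refine (measure_mono hsub).trans ((measure_biUnion_finset_le _ _).trans ?_)
  calc _ ≤ ∑ q ∈ T ×ˢ Finset.range (M + 1), ENNReal.ofReal b := by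
        refine Finset.sum_le_sum fun q hq => ?_
        exact measure_cell_le hσs hGs F hF (hT _ (Finset.mem_product.1 hq).1) (by positivity) hθ
          hγ hγ1 hc hε hind hlaw t
    _ = ENNReal.ofReal (T.card * (M + 1) * b) := by
        rw [Finset.sum_const, Finset.card_product, Finset.card_range, nsmul_eq_mul,
          ENNReal.ofReal_mul (by positivity)]
        congr 1
        rw [← ENNReal.ofReal_natCast]
        push_cast; rfl
    _ ≤ _ := by
        refine ENNReal.ofReal_le_ofReal ?_
        have : (M : ℝ) ≤ σmax / (σmin * θ) := Nat.floor_le (by positivity)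
        gcongr

end LikelihoodRatio

/-! ### Finite covers from metric entropy -/

section Cover

/-- A bound on the metric entropy yields a finite cover with centres in the class, at the price of
doubling the radius; so measurability of the class passes to the centres. -/
lemma exists_finset_cover_of_supEntropy_le {V : Type*} {D : ℕ} {F : Set (V → Fin D → ℝ)} {δ B : ℝ}
    (hδ : 0 ≤ δ) (h : supEntropy δ F ≤ (B : EReal)) :
    ∃ T : Finset (V → Fin D → ℝ), (∀ g ∈ T, g ∈ F) ∧ (T.card : ℝ) ≤ Real.exp B ∧
      ∀ g ∈ F, ∃ g' ∈ T, ∀ v, ‖g v - g' v‖ ≤ 2 * δ := by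
  set N := Metric.coveringNumber (2 * δ.toNNReal) (UniformFun.ofFun '' F) with hN
  have hNle : ((N : ℕ∞) : ENNReal) ≤ ENNReal.ofReal (Real.exp B) := by
    refine le_trans (ENat.toENNReal_mono
      (Metric.coveringNumber_two_mul_le_externalCoveringNumber _ _)) ?_
    rw [← ENNReal.log_le_log_iff, ENNReal.log_ofReal_of_pos (Real.exp_pos B), Real.log_exp]
    exact h
  have hNtop : N ≠ ⊤ := by
    intro htop
    rw [htop] at hNle
    simp at hNle
  obtain ⟨C, hCF, hCfin, hC, hcard⟩ := Metric.exists_set_encard_eq_coveringNumber hNtop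
  classical
  refine ⟨hCfin.toFinset.image UniformFun.toFun, ?_, ?_, ?_⟩
  · intro g hg
    obtain ⟨f, hf, rfl⟩ := Finset.mem_image.1 hg
    obtain ⟨g₀, hg₀, rfl⟩ := hCF (hCfin.mem_toFinset.1 hf)
    exact hg₀
  · rw [← hN, hCfin.encard_eq_coe_toFinset_card] at hcard
    rw [← hcard] at hNle
    have h1 : ((hCfin.toFinset.card : ℕ) : ENNReal) ≤ ENNReal.ofReal (Real.exp B) := by
      simpa using hNle
    rw [← ENNReal.ofReal_natCast, ENNReal.ofReal_le_ofReal_iff (Real.exp_pos B).le] at h1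
    exact (Nat.cast_le.2 Finset.card_image_le).trans h1
  · intro g hg
    obtain ⟨f, hf, hfg⟩ := hC (Set.mem_image_of_mem _ hg)
    refine ⟨UniformFun.toFun f, Finset.mem_image_of_mem _ (hCfin.mem_toFinset.2 hf), fun v => ?_⟩
    have h1 := UniformFun.edist_le.1 (show edist (UniformFun.ofFun g) f ≤ _ from hfg) v
    rw [edist_nndist, ENNReal.coe_le_coe, ← NNReal.coe_le_coe] at h1
    simpa [dist_eq_norm, hδ] using h1

end Cover

/-! ### Properties of the rate -/

section Rate

/-- The logarithm of the number of bracketing cells is at most a constant multiple of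
`ξ (A + log (n / σmin))`, uniformly in the sample size. -/
lemma card_cells_le {D n : ℕ} {N ξ A σmin σmax : ℝ} (hn : 1 ≤ n) (hσmin : 0 < σmin)
    (hσmin1 : σmin ≤ 1) (hσmax : 0 ≤ σmax) (hξ : 1 ≤ ξ) (hA : 1 ≤ A)
    (hN : N ≤ Real.exp (ξ * (A + max 1
      (Real.log (σmin * (1 / (384 * (D + 1) * n ^ 2)) / 2)⁻¹)))) :
    N * (σmax / (σmin * (1 / (384 * (D + 1) * n ^ 2))) + 1) ≤
      Real.exp ((6 + Real.log (768 * (D + 1)) + Real.log (1 + 384 * (D + 1) * σmax)) *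
        (ξ * (A + Real.log (n / σmin)))) := by
  have hn1 : (1 : ℝ) ≤ n := Nat.one_le_cast.2 hn
  have hn0 : (0 : ℝ) < n := by linarith
  have hD : (0 : ℝ) ≤ D := Nat.cast_nonneg D
  have hL1 : 1 ≤ (n : ℝ) / σmin := by rw [le_div_iff₀ hσmin]; linarith
  set L := Real.log (n / σmin) with hL
  have hL0 : 0 ≤ L := Real.log_nonneg hL1
  set b₁ := Real.log (768 * (D + 1)) with hb₁
  set b₂ := Real.log (1 + 384 * (D + 1) * σmax) with hb₂
  have hb₁0 : 0 ≤ b₁ := Real.log_nonneg (by nlinarith)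
  have hc2 : 1 ≤ 1 + 384 * (D + 1) * σmax := by
    have : 0 ≤ 384 * (D + 1) * σmax := by positivity
    linarith
  have hb₂0 : 0 ≤ b₂ := Real.log_nonneg hc2
  -- `1 / σmin ≤ 1 / σmin ^ 2` turns both counts into powers of `n / σmin`
  have hpow : (n : ℝ) ^ 2 / σmin ≤ (n / σmin) ^ 2 := by
    rw [div_pow]
    exact div_le_div_of_nonneg_left (by positivity) (by positivity) (by nlinarith)
  have hexpL : Real.exp (2 * L) = (n / σmin) ^ 2 := by
    rw [two_mul, Real.exp_add, hL, Real.exp_log (by positivity), sq]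
  have hlog : Real.log (σmin * (1 / (384 * (D + 1) * n ^ 2)) / 2)⁻¹ ≤ b₁ + 2 * L := by
    rw [Real.log_le_iff_le_exp (by positivity), Real.exp_add, hexpL, hb₁,
      Real.exp_log (by positivity)]
    calc (σmin * (1 / (384 * (D + 1) * (n : ℝ) ^ 2)) / 2)⁻¹ = 768 * (D + 1) * (n ^ 2 / σmin) := by
          field_simp; norm_num
      _ ≤ _ := by gcongr
  have hM : σmax / (σmin * (1 / (384 * (D + 1) * n ^ 2))) + 1 ≤ Real.exp (b₂ + 2 * L) := by
    rw [Real.exp_add, hexpL, hb₂, Real.exp_log (by linarith)]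
    calc σmax / (σmin * (1 / (384 * (D + 1) * (n : ℝ) ^ 2))) + 1
        = 384 * (D + 1) * σmax * (n ^ 2 / σmin) + 1 := by field_simp
      _ ≤ 384 * (D + 1) * σmax * (n / σmin) ^ 2 + (n / σmin) ^ 2 := by
          gcongr
          exact one_le_pow₀ hL1
      _ = _ := by ring
  calc _ ≤ Real.exp (ξ * (A + (1 + b₁ + 2 * L))) * Real.exp (b₂ + 2 * L) := by
        refine mul_le_mul (hN.trans (Real.exp_le_exp.2 ?_)) hM (by positivity)
          (Real.exp_pos _).le
        have hmax : max 1 (Real.log (σmin * (1 / (384 * (D + 1) * n ^ 2)) / 2)⁻¹) ≤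
            1 + b₁ + 2 * L := max_le (by linarith) (by linarith)
        have : 0 ≤ ξ := by linarith
        gcongr
    _ ≤ _ := by
        rw [← Real.exp_add]
        refine Real.exp_le_exp.2 ?_
        have hAL : 1 ≤ A + L := by linarith
        have hE : A + L ≤ ξ * (A + L) := le_mul_of_one_le_left (by linarith) hξ
        have h1 : ξ * (1 + b₁) ≤ (1 + b₁) * (ξ * (A + L)) := by
          have := mul_le_mul_of_nonneg_left hAL (by positivity : 0 ≤ (1 + b₁) * ξ)
          linarith
        have h2 : b₂ ≤ b₂ * (ξ * (A + L)) := le_mul_of_one_le_right hb₂0 (hAL.trans hE)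
        have h3 : ξ * L ≤ ξ * (A + L) := by gcongr; linarith
        have h4 : 0 ≤ ξ * A := by positivity
        nlinarith

lemma sq_mul_le_mul_sq_rate {C ξ A σmin δapp σs : ℝ} {n : ℕ} (hn : 1 ≤ n) (hC : 0 ≤ C)
    (hE : 0 ≤ ξ * (A + Real.log (n / σmin))) :
    C ^ 2 * (ξ * (A + Real.log (n / σmin))) ≤ n * rate C ξ A σmin δapp σs n ^ 2 := by
  have hn0 : (0 : ℝ) < n := Nat.cast_pos.2 hn
  have h1 := pow_le_pow_left₀ (by positivity)
    (mul_le_mul_of_nonneg_left (le_max_left (Real.sqrt (ξ * (A + Real.log (n / σmin)) / n))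
      (δapp / σs)) hC) 2
  rw [mul_pow, Real.sq_sqrt (by positivity)] at h1
  have h2 : n * (C ^ 2 * (ξ * (A + Real.log (n / σmin)) / n)) =
      C ^ 2 * (ξ * (A + Real.log (n / σmin))) := by field_simp
  rw [← h2]
  exact mul_le_mul_of_nonneg_left h1 hn0.le

lemma sq_mul_sq_le_sq_rate {C ξ A σmin δapp σs : ℝ} {n : ℕ} (hC : 0 ≤ C)
    (h : 0 ≤ δapp / σs) : C ^ 2 * (δapp / σs) ^ 2 ≤ rate C ξ A σmin δapp σs n ^ 2 := by
  rw [← mul_pow]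
  exact pow_le_pow_left₀ (by positivity) (mul_le_mul_of_nonneg_left (le_max_right _ _) hC) 2

/-- The radius of the cover used at sample size `n` lies in the range where the entropy is
controlled, because the rate is at least of order `1 / n`. -/
lemma cover_radius_le {D n : ℕ} {C ξ A σmin δapp σs δs : ℝ} (hn : 1 ≤ n) (hσmin1 : σmin ≤ 1)
    (hδs : 0 ≤ δs) (hC : 2 ≤ C) (hE : 1 ≤ ξ * (A + Real.log (n / σmin)))
    (hrate : rate C ξ A σmin δapp σs n ≤ Real.sqrt 2 * δs) :
    σmin * (1 / (384 * (D + 1) * n ^ 2)) / 2 ≤ δs := by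
  have hn1 : (1 : ℝ) ≤ n := Nat.one_le_cast.2 hn
  have hn0 : (0 : ℝ) < n := by linarith
  have hD : (0 : ℝ) ≤ D := Nat.cast_nonneg D
  have h0 : C * Real.sqrt (ξ * (A + Real.log (n / σmin)) / n) ≤ rate C ξ A σmin δapp σs n :=
    mul_le_mul_of_nonneg_left (le_max_left _ _) (by linarith)
  generalize ξ * (A + Real.log (n / σmin)) = E at h0 hE
  have h1 : 1 / (n : ℝ) ≤ Real.sqrt (E / n) := by
    refine Real.le_sqrt_of_sq_le ?_
    rw [div_pow, one_pow, div_le_div_iff₀ (by positivity) hn0, sq, one_mul, ← mul_assoc]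
    exact le_mul_of_one_le_left hn0.le (one_le_mul_of_one_le_of_one_le hE hn1)
  have h2 : Real.sqrt 2 ≤ 2 := Real.sqrt_le_iff.2 ⟨by norm_num, by norm_num⟩
  have h3 : 1 / (384 * ((D : ℝ) + 1) * n ^ 2) ≤ 1 / n :=
    one_div_le_one_div_of_le hn0 (by nlinarith [mul_nonneg hD (sq_nonneg (n : ℝ))])
  have h4 := mul_le_mul hσmin1 h3 (by positivity) zero_le_one
  have h5 := mul_le_mul_of_nonneg_right h2 hδs
  have h6 := mul_le_mul_of_nonneg_right hC (Real.sqrt_nonneg (E / n))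
  have h7 : 0 ≤ 1 / (n : ℝ) := by positivity
  linarith

lemma six_mul_mesh_le {D n : ℕ} (hn : 1 ≤ n) :
    6 * (D : ℝ) * (1 / (384 * (D + 1) * n ^ 2)) ≤ 1 / (64 * n ^ 2) := by
  have hn0 : (0 : ℝ) < n := Nat.cast_pos.2 hn
  rw [mul_one_div, div_le_div_iff₀ (by positivity) (by positivity)]
  nlinarith [sq_nonneg (n : ℝ)]

end Rate

/-! ### Deviations of the sieve maximum likelihood estimator -/

section SieveMLE

variable {Z X Ω : Type*} [MeasurableSpace Z] [MeasurableSpace X] [MeasurableSpace Ω] {D n : ℕ}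
  {PZ : Measure Z} [IsProbabilityMeasure PZ] {μ : Measure X} [IsProbabilityMeasure μ]
  {P : Measure Ω} {W : Fin n → Ω → X × (Fin D → ℝ)}

/-- The deviation bound for a sieve maximum likelihood estimator, at every radius `ε` for which the
approximation error, the optimization error and the number of cells are dominated by `n ε²`. -/
lemma measure_sieveMLE_far_le {σs σmin σmax θ δ ε η : ℝ} {Gs G : Z × X → Fin D → ℝ}
    {F : Set (Z × X → Fin D → ℝ)} (hn : 1 ≤ n) (hF : ∀ g ∈ F, Measurable g) (hσmin : 0 < σmin)
    (hσs : σs ∈ Set.Icc σmin σmax) (hGs : Measurable Gs) (hG : G ∈ F)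
    (hGd : ∀ w, ‖G w - Gs w‖ ≤ δ) (T : Finset (Z × X → Fin D → ℝ)) (hTF : ∀ g ∈ T, g ∈ F)
    (hTcover : ∀ g ∈ F, ∃ g' ∈ T, ∀ w, ‖g w - g' w‖ ≤ σmin * θ) (hθ : 0 < θ)
    (hθγ : 6 * D * θ ≤ 1 / (64 * n ^ 2)) (hε : 0 < ε) (hnε : 1 ≤ n * ε ^ 2)
    (happ : 24 * (n * (D * (δ / σs) ^ 2)) ≤ n * ε ^ 2)
    (hcells : T.card * (σmax / (σmin * θ) + 1) ≤ Real.exp (n * ε ^ 2 / 8))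
    (hind : iIndepFun W P) (hlaw : ∀ i, HasLaw (W i) (pairLaw μ (condDensity PZ Gs σs)) P)
    {ghat : Ω → Z × X → Fin D → ℝ} {σhat : Ω → ℝ}
    (hmle : ∀ ω, IsSieveMLE PZ F σmin σmax η (fun i => W i ω) (ghat ω) (σhat ω))
    (hη : η ≤ ε ^ 2 / 6) :
    P {ω | ε < integratedHellinger μ (condDensity PZ (ghat ω) (σhat ω))
        (condDensity PZ Gs σs)} ≤ ENNReal.ofReal (2 * Real.exp (-(1 / 24) * n * ε ^ 2)) := by
  have hσs0 : 0 < σs := hσmin.trans_le hσs.1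
  have hσmax : 0 ≤ σmax := hσs0.le.trans hσs.2
  have hn1 : (1 : ℝ) ≤ n := Nat.one_le_cast.2 hn
  have hn0 : (0 : ℝ) < n := by linarith
  have hγ1 : 1 / (64 * (n : ℝ) ^ 2) ≤ 1 := by
    rw [div_le_one (by positivity)]; nlinarith
  have happrox := measure_le_sum_log_approx_le hσs0 hGs (hF G hG) hGd hind hlaw (n * ε ^ 2 / 12)
  have hfar := measure_exists_far_le hσs0 hGs F hF T (fun g hg => hF g (hTF g hg)) hσmin hσmax hθ
    hTcover hθγ hγ1 (by positivity : (0 : ℝ) < 8 * n) hε hind hlaw (-(n * ε ^ 2 / 4))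
  have hsub : {ω | ε < integratedHellinger μ (condDensity PZ (ghat ω) (σhat ω))
        (condDensity PZ Gs σs)} ⊆
      {ω | n * ε ^ 2 / 12 ≤ ∑ i, (Real.log (condDensity PZ Gs σs (W i ω).1 (W i ω).2) -
        Real.log (condDensity PZ G σs (W i ω).1 (W i ω).2))} ∪
      {ω | ∃ g ∈ F, ∃ σ ∈ Set.Icc σmin σmax,
        ε < integratedHellinger μ (condDensity PZ g σ) (condDensity PZ Gs σs) ∧
        -(n * ε ^ 2 / 4) ≤ ∑ i, (Real.log (condDensity PZ g σ (W i ω).1 (W i ω).2) -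
          Real.log (condDensity PZ Gs σs (W i ω).1 (W i ω).2))} := by
    intro ω hω
    obtain ⟨hg, hσ, hmax⟩ := hmle ω
    rcases le_or_gt (n * ε ^ 2 / 12) (∑ i,
      (Real.log (condDensity PZ Gs σs (W i ω).1 (W i ω).2) -
        Real.log (condDensity PZ G σs (W i ω).1 (W i ω).2))) with h | h
    · exact Or.inl h
    · refine Or.inr ⟨ghat ω, hg, σhat ω, hσ, hω, ?_⟩
      have h1 := mul_le_mul_of_nonneg_left (hmax G hG σs hσs) hn0.le
      simp only [logLik, mul_sub, mul_inv_cancel_left₀ hn0.ne'] at h1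
      have h2 := mul_le_mul_of_nonneg_left hη hn0.le
      rw [Finset.sum_sub_distrib] at h ⊢
      linarith
  refine (measure_mono hsub).trans ((measure_union_le _ _).trans
    ((add_le_add happrox hfar).trans ?_))
  rw [← ENNReal.ofReal_add (Real.exp_pos _).le (by positivity)]
  refine ENNReal.ofReal_le_ofReal ?_
  have hexp1 : Real.exp (n * (D * (δ / σs) ^ 2) - n * ε ^ 2 / 12) ≤
      Real.exp (-(1 / 24) * n * ε ^ 2) := Real.exp_le_exp.2 (by linarith)
  have hexp2 : T.card * (σmax / (σmin * θ) + 1) * Real.exp (n * (-(ε ^ 2 / 2) +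
      (8 * n * (1 / (64 * n ^ 2)) + (8 * (n : ℝ))⁻¹) / 2) - -(n * ε ^ 2 / 4) / 2) ≤
      Real.exp (-(1 / 24) * n * ε ^ 2) := by
    refine (mul_le_mul_of_nonneg_right hcells (Real.exp_pos _).le).trans ?_
    rw [← Real.exp_add]
    refine Real.exp_le_exp.2 ?_
    have h1 : (n : ℝ) * ((8 * n * (1 / (64 * n ^ 2)) + (8 * (n : ℝ))⁻¹) / 2) = 1 / 8 := by
      field_simp; norm_num
    rw [mul_add, h1]
    linarith
  linarith

end SieveMLE

end CondGen

theorem theorem1 :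
    ∃ C₁ : ℝ, 0 < C₁ ∧
    ∀ D : ℕ, ∃ C₂ : ℝ, 0 < C₂ ∧
    ∀ K σmax : ℝ, ∃ C₃ : ℝ, 0 < C₃ ∧
    -- the latent space, the predictor space, and the laws of `Z` and `X`
    ∀ (d p : ℕ) (ZZ : Set (EuclideanSpace ℝ (Fin d))) (XX : Set (EuclideanSpace ℝ (Fin p)))
      (PZ : Measure ZZ) [IsProbabilityMeasure PZ] (μX : Measure XX) [IsProbabilityMeasure μX]
      -- the generator class, its entropy and its approximation error
      (F : Set (ZZ × XX → Fin D → ℝ)) (δs ξ A δapp σmin σs : ℝ)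
      (Gs G : ZZ × XX → Fin D → ℝ),
      (∀ g ∈ F, Measurable g) →
      (∀ g ∈ F, ∀ w, ‖g w‖ ≤ K) →
      0 < σmin → σmin ≤ 1 → σs ∈ Set.Icc σmin σmax →
      1 ≤ ξ → 1 ≤ A → 0 < δs →
      (∀ δ : ℝ, 0 < δ → δ ≤ δs →
        CondGen.supEntropy δ F ≤ ((ξ * (A + max 1 (Real.log δ⁻¹)) : ℝ) : EReal)) →
      0 < δapp → δapp ≤ δs → δapp ≤ 1 →
      Measurable Gs → G ∈ F → (∀ w, ‖G w - Gs w‖ ≤ δapp) →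
    -- the sample `(X_1, Y_1), …, (X_n, Y_n)` and the sieve MLE
    ∀ (n : ℕ), 1 ≤ n →
    ∀ (Ω : Type*) [MeasurableSpace Ω] (P : Measure Ω) [IsProbabilityMeasure P]
      (X : Fin n → Ω → XX) (Y : Fin n → Ω → Fin D → ℝ),
      iIndepFun (fun i ω => (X i ω, Y i ω)) P →
      (∀ i, HasLaw (fun ω => (X i ω, Y i ω))
        (CondGen.pairLaw μX (CondGen.condDensity PZ Gs σs)) P) →
    ∀ (η : ℝ) (ghat : Ω → ZZ × XX → Fin D → ℝ) (σhat : Ω → ℝ),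
      (∀ ω, CondGen.IsSieveMLE PZ F σmin σmax η (fun i => (X i ω, Y i ω)) (ghat ω) (σhat ω)) →
      η ≤ (CondGen.rate C₃ ξ A σmin δapp σs n) ^ 2 / 6 →
      CondGen.rate C₃ ξ A σmin δapp σs n ≤ Real.sqrt 2 * δs →
      P {ω | CondGen.rate C₃ ξ A σmin δapp σs n <
          CondGen.integratedHellinger μX (CondGen.condDensity PZ (ghat ω) (σhat ω))
            (CondGen.condDensity PZ Gs σs)} ≤
        ENNReal.ofReal
          (5 * Real.exp (-C₁ * n * (CondGen.rate C₃ ξ A σmin δapp σs n) ^ 2) + C₂ / n) := by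
  refine ⟨1 / 24, by norm_num, fun D => ⟨1, one_pos, fun K σmax => ?_⟩⟩
  -- `B` controls the log-number of cells; `C₃ ^ 2 ≥ 8 B` makes the union bound affordable and
  -- `C₃ ^ 2 ≥ 24 D` absorbs the approximation error; the absolute value keeps `B` positive for
  -- every real `σmax`
  set B : ℝ := 6 + Real.log (768 * (D + 1)) + Real.log (1 + 384 * (D + 1) * |σmax|) with hB
  have hD : (0 : ℝ) ≤ D := Nat.cast_nonneg D
  have hB6 : 6 ≤ B := by
    have h1 : 0 ≤ Real.log (768 * ((D : ℝ) + 1)) := Real.log_nonneg (by linarith)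
    have h2 : 0 ≤ Real.log (1 + 384 * ((D : ℝ) + 1) * |σmax|) :=
      Real.log_nonneg (by have : 0 ≤ 384 * ((D : ℝ) + 1) * |σmax| := by positivity
                          linarith)
    linarith
  have hC48 : 48 ≤ 8 * B + 24 * D := by linarith
  refine ⟨8 * B + 24 * D, by linarith, ?_⟩
  obtain ⟨C, hC⟩ : ∃ C : ℝ, C = 8 * B + 24 * D := ⟨_, rfl⟩
  rw [← hC]
  have hCsq : C ≤ C ^ 2 := by rw [sq]; exact le_mul_of_one_le_left (by linarith) (by linarith)
  have hCB : 8 * B ≤ C := by linarith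
  have hCD : 24 * D ≤ C := by linarith
  intro d p ZZ XX PZ _ μX _ F δs ξ A δapp σmin σs Gs G hF _ hσmin hσmin1 hσs hξ hA hδs hent
    hδapp _ _ hGs hG hGd n hn Ω _ P _ X Y hind hlaw η ghat σhat hmle hη hrate
  have hσs0 : 0 < σs := hσmin.trans_le hσs.1
  have hσmax : 0 ≤ σmax := hσs0.le.trans hσs.2
  rw [abs_of_nonneg hσmax] at hB
  have hn1 : (1 : ℝ) ≤ n := Nat.one_le_cast.2 hn
  have hn0 : (0 : ℝ) < n := by linarith
  have hL0 : 0 ≤ Real.log (n / σmin) :=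
    Real.log_nonneg (by rw [le_div_iff₀ hσmin]; linarith)
  have hE1 : 1 ≤ ξ * (A + Real.log (n / σmin)) :=
    one_le_mul_of_one_le_of_one_le hξ (by linarith)
  have hu : 0 < δapp / σs := div_pos hδapp hσs0
  have hε0 : 0 < CondGen.rate C ξ A σmin δapp σs n :=
    mul_pos (by linarith) (lt_max_of_lt_right hu)
  have hE2 := CondGen.sq_mul_le_mul_sq_rate (C := C) (δapp := δapp) (σs := σs) hn
    (by linarith) (zero_le_one.trans hE1)
  have hu2 := CondGen.sq_mul_sq_le_sq_rate (C := C) (ξ := ξ) (A := A) (σmin := σmin) (n := n)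
    (by linarith) hu.le
  have hδ := CondGen.cover_radius_le (D := D) hn hσmin1 hδs.le (by linarith) hE1 hrate
  set ε := CondGen.rate C ξ A σmin δapp σs n
  have hnE : 8 * B * (ξ * (A + Real.log (n / σmin))) ≤ n * ε ^ 2 :=
    (mul_le_mul_of_nonneg_right (by linarith) (by linarith)).trans hE2
  have hnε : 1 ≤ n * ε ^ 2 :=
    (one_le_mul_of_one_le_of_one_le (by linarith) hE1).trans hnE
  have hnu : 24 * (n * (D * (δapp / σs) ^ 2)) ≤ n * ε ^ 2 := by
    have h1 : 24 * (D : ℝ) * (δapp / σs) ^ 2 ≤ C ^ 2 * (δapp / σs) ^ 2 :=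
      mul_le_mul_of_nonneg_right (by linarith) (sq_nonneg _)
    linarith [mul_le_mul_of_nonneg_left (h1.trans hu2) hn0.le]
  -- the relative mesh is of order `n⁻²`, so that the excess mass of the brackets is at most
  -- `(8 n)⁻²`
  set θ : ℝ := 1 / (384 * (D + 1) * n ^ 2) with hθ
  have hθ0 : 0 < θ := by positivity
  obtain ⟨T, hTF, hTcard, hTcover⟩ := CondGen.exists_finset_cover_of_supEntropy_le
    (by positivity) (hent (σmin * θ / 2) (by positivity) hδ)
  rw [mul_div_cancel₀ _ two_ne_zero] at hTcover
  have hcells := CondGen.card_cells_le hn hσmin hσmin1 hσmax hξ hA hTcard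
  rw [← hθ, ← hB] at hcells
  refine (CondGen.measure_sieveMLE_far_le (W := fun i ω => (X i ω, Y i ω)) hn hF hσmin hσs hGs hG
    hGd T hTF hTcover hθ0 (CondGen.six_mul_mesh_le hn) hε0 hnε hnu
    (hcells.trans (Real.exp_le_exp.2 (by linarith))) hind hlaw hmle hη).trans (ENNReal.ofReal_le_ofReal ?_)
  have hpos := Real.exp_pos (-(1 / 24) * n * ε ^ 2)
  have hinv : 0 ≤ 1 / (n : ℝ) := by positivity
  linarith
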